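/- Let $H(\mathbb U)$ be the space of analytic functions on the open unit disk $\mathbb U$, and write $f(z)=\sum_{n\ge 0}\hat f(n)z^n$ for $f\in H(\mathbb U)$. For $1\le p\le\infty$ let $H_p$ be the Hardy space of all $f\in H(\mathbb U)$ with $\|f\|_{H_p}=\sup_{0\le r<1}\|f_r\|_{L_p}<\infty$, where $f_r(t)=f(re^{it})$ and $L_p$ is taken on $[0,2\pi]$ with normalized Lebesgue measure. The symbol $\hookrightarrow$ denotes a continuous inclusion. Let $X\subset H(\mathbb U)$ be a complex Banach space of analytic functions with $H_\infty\hookrightarrow X\hookrightarrow H_2$. Let $E$ be a Banach sequence lattice, that is, a Banach space of complex sequences indexed by $\mathbb Z_+=\{0,1,2,\dots\}$ such that, whenever $(x_n)\in E$ and $|y_n|\le|x_n|$ for all $n$, one has $(y_n)\in E$ and $\|(y_n)\|_E\le\|(x_n)\|_E$. Assume that $E\hookrightarrow\ell_\infty$ and that, for some $0<u<2$, $E$ satisfies a lower $u$-estimate: there is a constant $C>0$ such that \[ \Big\|\sum_{i=1}^m x_i\Big\|_E\ \ge\ \frac1C\Big(\sum_{i=1}^m\|x_i\|_E^u\Big)^{1/u}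 \] for all finite families $x_1,\dots,x_m\in E$ with pairwise disjoint supports. Then, for every complex sequence $\lambda=(\lambda_n)_{n\ge0}$, the following are equivalent: 1. the multiplier operator $M_\lambda\colon X\to E$, $M_\lambda f=(\lambda_n\hat f(n))_{n\ge0}$, is well defined (i.e. $(\lambda_n\hat f(n))_n\in E$ for every $f\in X$), bounded and compact; 2. $\lambda\in\mathcal M(\ell_2,E)$, i.e. $(\lambda_nx_n)_{n\ge0}\in E$ for every $x=(x_n)\in\ell_2$. -/

import Mathlib

open scoped ENNReal NNReal

noncomputable section

/-- The complex vector space `H(𝕌)` of analytic functions on the open unit disk. A function on the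
disk is represented by its extension by zero to `ℂ`, so that two elements are equal exactly when
they agree on the disk. -/
def AnalyticDisk : Submodule ℂ (ℂ → ℂ) where
  carrier := {f | DifferentiableOn ℂ f (Metric.ball 0 1) ∧ ∀ z, z ∉ Metric.ball (0 : ℂ) 1 → f z = 0}
  add_mem' := by
    rintro f g ⟨hf, hf0⟩ ⟨hg, hg0⟩
    exact ⟨hf.add hg, fun z hz => by simp [hf0 z hz, hg0 z hz]⟩
  zero_mem' := ⟨differentiableOn_const 0, fun _ _ => rfl⟩
  smul_mem' := by
    rintro c f ⟨hf, hf0⟩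
    exact ⟨hf.const_smul c, fun z hz => by simp [hf0 z hz]⟩

/-- The `n`-th Taylor coefficient at the origin. -/
def taylorCoeff (f : AnalyticDisk) (n : ℕ) : ℂ :=
  iteratedDeriv n (f : ℂ → ℂ) 0 / (n.factorial : ℂ)

/-- Normalized Lebesgue measure on `(0, 2π]`. -/
def circleMeasure : MeasureTheory.Measure ℝ :=
  (ENNReal.ofReal (2 * Real.pi))⁻¹ •
    MeasureTheory.volume.restrict (Set.Ioc 0 (2 * Real.pi))

/-- The Hardy norm `sup_{0 ≤ r < 1} ‖f_r‖_{L_p}`, where `f_r(t) = f(r e^{it})`, with value `∞` when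
`f` is not in the Hardy space `H_p`. -/
def hardyENorm (p : ℝ≥0∞) (f : AnalyticDisk) : ℝ≥0∞ :=
  ⨆ r ∈ Set.Ico (0 : ℝ) 1,
    MeasureTheory.eLpNorm (fun t : ℝ => (f : ℂ → ℂ) (r * Complex.exp (t * Complex.I)))
      p circleMeasure

/-- Continuous inclusion `H_p ↪ X`, for a space `X` realized in `H(𝕌)` by the map `J`. -/
def HardyEmbedsInto (p : ℝ≥0∞) {X : Type*} [NormedAddCommGroup X] [NormedSpace ℂ X]
    (J : X →ₗ[ℂ] AnalyticDisk) : Prop :=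
  ∃ C : ℝ≥0, ∀ f : AnalyticDisk, hardyENorm p f < ∞ →
    ∃ x : X, J x = f ∧ ‖x‖ₑ ≤ C * hardyENorm p f

/-- Continuous inclusion `X ↪ H_p`, for a space `X` realized in `H(𝕌)` by the map `J`. -/
def EmbedsIntoHardy (p : ℝ≥0∞) {X : Type*} [NormedAddCommGroup X] [NormedSpace ℂ X]
    (J : X →ₗ[ℂ] AnalyticDisk) : Prop :=
  ∃ C : ℝ≥0, ∀ x : X, hardyENorm p (J x) ≤ C * ‖x‖ₑ

/-- The Banach space `E`, realized as a space of complex sequences on `ℤ₊` by the injective linear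
map `S`, is a Banach sequence lattice: an ideal of sequences with monotone norm. -/
structure IsBanachSequenceLattice {E : Type*} [NormedAddCommGroup E] [NormedSpace ℂ E]
    (S : E →ₗ[ℂ] (ℕ → ℂ)) : Prop where
  complete : CompleteSpace E
  injective : Function.Injective S
  solid : ∀ (x : E) (y : ℕ → ℂ), (∀ n, ‖y n‖ ≤ ‖S x n‖) → ∃ y' : E, S y' = y ∧ ‖y'‖ ≤ ‖x‖

/-- Continuous inclusion `E ↪ ℓ_∞` for a sequence space `E`. -/
def EmbedsIntoLInfty {E : Type*} [NormedAddCommGroup E] [NormedSpace ℂ E]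
    (S : E →ₗ[ℂ] (ℕ → ℂ)) : Prop :=
  ∃ C : ℝ, ∀ (x : E) (n : ℕ), ‖S x n‖ ≤ C * ‖x‖

/-- Lower `u`-estimate: `(1/C) (∑ ‖x_i‖^u)^{1/u} ≤ ‖∑ x_i‖` for finitely many elements with
pairwise disjoint supports. -/
def LowerEstimate (u : ℝ) {E : Type*} [NormedAddCommGroup E] [NormedSpace ℂ E]
    (S : E →ₗ[ℂ] (ℕ → ℂ)) : Prop :=
  ∃ C : ℝ, 0 < C ∧ ∀ (m : ℕ) (x : Fin m → E),
    (∀ i j, i ≠ j → ∀ n, S (x i) n = 0 ∨ S (x j) n = 0) →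
      1 / C * (∑ i, ‖x i‖ ^ u) ^ (1 / u) ≤ ‖∑ i, x i‖

/-- The set `𝓜(F, E)` of multipliers between two sets of sequences. -/
def multipliers (F E : Set (ℕ → ℂ)) : Set (ℕ → ℂ) :=
  {l | ∀ x ∈ F, (fun n => l n * x n) ∈ E}

/-- The sequences in `ℓ_2`. -/
def ellTwo : Set (ℕ → ℂ) := {x | Memℓp x 2}

/-- `M_λ : X → E`, `f ↦ (λ_n f̂(n))_n`, is a well-defined bounded operator and is compact. -/
def IsCompactMultiplier {X E : Type*} [NormedAddCommGroup X] [NormedSpace ℂ X]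
    [NormedAddCommGroup E] [NormedSpace ℂ E]
    (J : X →ₗ[ℂ] AnalyticDisk) (S : E →ₗ[ℂ] (ℕ → ℂ)) (l : ℕ → ℂ) : Prop :=
  ∃ M : X →L[ℂ] E, (∀ x n, S (M x) n = l n * taylorCoeff (J x) n) ∧ IsCompactOperator M

end

/-! From 1 to 2, the point is that `H_∞` nearly contains `ℓ₂` up to signs. For finite `a` with `s =
∑ |a n|²`, some choice of signs gives a polynomial `g` with fourth moment at most `3 s²`. If `Re h =
|g|²` on the circle, then `F = g / (1 + δ² h)` is bounded by a multiple of `√s` and is `L₂`-close to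
`g`, so `2 |F̂ n| ≥ |a n|` off a set carrying at most a quarter of `s`
(`exists_hardy_top_dominating`). Solidity of `E` bounds the dominated part of `(l n * a n)`;
repeating the argument on the rest gives an `ℓ₂` bound independent of the length of `a`
(`exists_bound_finite_multiplier`), and completeness extends it to all of `ℓ₂`.

From 2 to 1, the multiplier factors as `X → ℓ₂ → E`, through the Taylor coefficients and a diagonal
operator `D`. If `D` were not small on tails, there would be disjoint unit-ball blocks with images
of norm above `δ`; the sum of `m` of them has norm at most `m^(1/2)`, while its image has norm at
least of order `m^(1/u)`, which is impossible for `u < 2`. Hence `D` is a norm limit of finite-rank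
truncations. -/

lemma Continuous.circleIntegrable {E : Type*} [NormedAddCommGroup E] {f : ℂ → E}
    (hf : Continuous f) (c : ℂ) (R : ℝ) : CircleIntegrable f c R :=
  hf.continuousOn.circleIntegrable'

/-! ### Fourier and Taylor coefficients on a circle -/

open Metric Real in
/-- The nonnegative Fourier coefficients of an analytic function on a circle are, up to powers of
the radius, its Taylor coefficients. -/
lemma fourierCoeffOn_circleMap {F : ℂ → ℂ} {R : ℝ} (hR : 0 < R)
    (hF : DiffContOnCl ℂ F (ball 0 R)) (n : ℕ) :
    fourierCoeffOn two_pi_pos (fun θ => F (circleMap 0 R θ)) n =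
      R ^ n * (iteratedDeriv n F 0 / n.factorial) := by
  have hc := hF.circleIntegral_one_div_sub_center_pow_smul hR n
  have hRC : (R : ℂ) ≠ 0 := by exact_mod_cast hR.ne'
  have hπ : (π : ℂ) ≠ 0 := by exact_mod_cast pi_ne_zero
  have hfac : (n.factorial : ℂ) ≠ 0 := by exact_mod_cast n.factorial_ne_zero
  -- With `dz = i z dθ`, the Fourier integrand becomes the Cauchy integrand for the `n`-th
  -- derivative.
  have key : ∀ θ : ℝ, fourier (-(n : ℤ)) (θ : AddCircle (2 * π - 0)) • F (circleMap 0 R θ) =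
      (R ^ n / Complex.I) * (deriv (circleMap 0 R) θ •
        ((1 / (circleMap 0 R θ - 0) ^ (n + 1)) • F (circleMap 0 R θ))) := by
    intro θ
    have hexp : Complex.exp (θ * Complex.I) ≠ 0 := Complex.exp_ne_zero _
    have : fourier (-(n : ℤ)) (θ : AddCircle (2 * π - 0)) =
        (Complex.exp (θ * Complex.I) ^ n)⁻¹ := by
      rw [fourier_coe_apply, ← Complex.exp_nat_mul, ← Complex.exp_neg]
      congr 1
      push_cast
      field_simp
      simp only [sub_zero]
      ring
    rw [this]
    simp only [deriv_circleMap, circleMap, zero_add, sub_zero, smul_eq_mul]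
    field_simp
    ring
  rw [fourierCoeffOn_eq_integral]
  simp_rw [key]
  rw [intervalIntegral.integral_const_mul]
  change _ • (_ * ∮ z in C(0, R), (1 / (z - 0) ^ (n + 1)) • F z) = _
  rw [hc]
  simp only [Complex.real_smul, smul_eq_mul]
  push_cast
  field_simp
  simp

open Metric Real in
/-- Bessel's inequality for the Taylor coefficients of an analytic function. -/
lemma sum_sq_taylor_le_circleAverage {F : ℂ → ℂ} {R : ℝ} (hR : 0 < R)
    (hF : DiffContOnCl ℂ F (ball 0 R)) (s : Finset ℕ) :
    ∑ n ∈ s, ‖(R : ℂ) ^ n * (iteratedDeriv n F 0 / n.factorial)‖ ^ 2 ≤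
      circleAverage (fun z => ‖F z‖ ^ 2) 0 R := by
  have hcont : Continuous fun θ : ℝ => F (circleMap 0 R θ) :=
    hF.continuousOn_ball.comp_continuous (continuous_circleMap 0 R)
      fun θ => circleMap_mem_closedBall 0 hR.le θ
  have hL2 : MeasureTheory.MemLp (fun θ : ℝ => F (circleMap 0 R θ)) 2
      (MeasureTheory.volume.restrict (Set.Ioc 0 (2 * π))) := by
    obtain ⟨C, hC⟩ := (isCompact_Icc (a := (0 : ℝ)) (b := 2 * π)).exists_bound_of_continuousOn
      hcont.continuousOn
    refine MeasureTheory.MemLp.of_bound hcont.aestronglyMeasurable C ?_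
    filter_upwards [MeasureTheory.ae_restrict_mem measurableSet_Ioc] with θ hθ
    exact hC θ (Set.Ioc_subset_Icc_self hθ)
  -- Parseval over `ℤ`, keeping only the indices in `s`.
  have h := sum_le_hasSum (s.map Nat.castEmbedding) (fun _ _ => by positivity)
    (hasSum_sq_fourierCoeffOn two_pi_pos hL2)
  simp only [Finset.sum_map, Nat.castEmbedding_apply, fourierCoeffOn_circleMap hR hF] at h
  simpa [circleAverage] using h

/-! ### Quadratic means on the unit circle -/

open Real in
/-- Mean value property on the unit circle. -/
lemma Differentiable.circleAverage_eq {F : ℂ → ℂ} (hF : Differentiable ℂ F) :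
    circleAverage F 0 1 = F 0 := hF.diffContOnCl.circleAverage

open Real in
lemma Differentiable.circleAverage_re {F : ℂ → ℂ} (hF : Differentiable ℂ F) :
    circleAverage (fun z => (F z).re) 0 1 = (F 0).re := by
  rw [← hF.circleAverage_eq]
  exact Complex.reCLM.circleAverage_comp_comm
    (hF.continuous.circleIntegrable _ _)

open Real in
/-- The conjugate function has no larger quadratic mean. -/
lemma circleAverage_norm_sq_le {h : ℂ → ℂ} (hh : Differentiable ℂ h) (h0 : (h 0).im = 0) :
    circleAverage (fun z => ‖h z‖ ^ 2) 0 1 ≤ 2 * circleAverage (fun z => (h z).re ^ 2) 0 1 := by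
  have hc := hh.continuous
  have h2 : circleAverage (fun z => (h z ^ 2).re) 0 1 = (h 0 ^ 2).re :=
    (hh.pow 2).circleAverage_re
  have hpos : 0 ≤ (h 0 ^ 2).re := by
    simp only [pow_two, Complex.mul_re, h0]; nlinarith [sq_nonneg (h 0).re]
  -- The mean of `Re (h²)` is `Re (h(0)²)`, nonnegative because `h 0` is real, so it can be dropped.
  have e : (fun z => ‖h z‖ ^ 2) = fun z => (2 : ℝ) • (h z).re ^ 2 - (h z ^ 2).re := by
    ext z
    rw [Complex.sq_norm, Complex.normSq_apply]
    simp only [pow_two, Complex.mul_re, smul_eq_mul]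
    ring
  rw [e, circleAverage_fun_sub, circleAverage_fun_smul, h2, smul_eq_mul]
  · linarith
  all_goals exact Continuous.circleIntegrable (by fun_prop) _ _

open Finset in
/-- On the unit circle the square modulus of a polynomial is the real part of a polynomial. -/
lemma exists_entire_re_eq_norm_sq (b : ℕ → ℂ) (k : ℕ) :
    ∃ h : ℂ → ℂ, Differentiable ℂ h ∧ h 0 = ((∑ n ∈ range k, ‖b n‖ ^ 2 : ℝ) : ℂ) ∧
      ∀ z : ℂ, ‖z‖ = 1 → (h z).re = ‖∑ n ∈ range k, b n * z ^ n‖ ^ 2 := by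
  induction k with
  | zero => exact ⟨fun _ => 0, by fun_prop, by simp, by simp⟩
  | succ k ih =>
    obtain ⟨h, hd, h0, hre⟩ := ih
    -- The last term is the cross term `2 b_k z^k * conj (∑ b_j z^j)`, with `conj z = 1/z` on the
    -- circle. All exponents `k - j` are positive, so it is a polynomial vanishing at `0`.
    refine ⟨fun z => h z + ((‖b k‖ ^ 2 : ℝ) : ℂ) +
      2 * (b k * ∑ j ∈ range k, (starRingEnd ℂ) (b j) * z ^ (k - j)), by fun_prop, ?_, ?_⟩
    · have : ∑ j ∈ range k, (starRingEnd ℂ) (b j) * (0 : ℂ) ^ (k - j) = 0 := by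
        refine sum_eq_zero fun j hj => ?_
        have := mem_range.1 hj
        rw [zero_pow (by omega), mul_zero]
      simp only [h0, this, sum_range_succ]
      push_cast
      ring
    · intro z hz
      have hzz : z * (starRingEnd ℂ) z = 1 := by
        simp [Complex.mul_conj, Complex.normSq_eq_norm_sq, hz]
      have hconj : b k * ∑ j ∈ range k, (starRingEnd ℂ) (b j) * z ^ (k - j) =
          (b k * z ^ k) * (starRingEnd ℂ) (∑ n ∈ range k, b n * z ^ n) := by
        rw [map_sum, mul_sum, mul_sum]
        refine sum_congr rfl fun j hj => ?_
        have hjk : k = (k - j) + j := by have := mem_range.1 hj; omega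
        have : z ^ k * (starRingEnd ℂ) z ^ j = z ^ (k - j) := by
          conv_lhs => rw [hjk, pow_add, mul_assoc, ← mul_pow, hzz, one_pow, mul_one]
        rw [map_mul, map_pow, ← this]
        ring
      rw [sum_range_succ, add_comm (∑ n ∈ range k, b n * z ^ n),
        ← Complex.normSq_eq_norm_sq (b k * z ^ k + _), Complex.normSq_add]
      simp only [hconj]
      simp only [Complex.add_re, Complex.ofReal_re, hre z hz, Complex.normSq_eq_norm_sq, norm_mul,
        norm_pow, hz]
      simp
      ring

open Finset Real in
lemma circleAverage_norm_sq_polynomial (b : ℕ → ℂ) (k : ℕ) :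
    circleAverage (fun z => ‖∑ n ∈ range k, b n * z ^ n‖ ^ 2) 0 1 = ∑ n ∈ range k, ‖b n‖ ^ 2 := by
  obtain ⟨h, hd, h0, hre⟩ := exists_entire_re_eq_norm_sq b k
  have := hd.circleAverage_re
  rw [h0, Complex.ofReal_re] at this
  rw [← this]
  exact circleAverage_congr_sphere fun z hz => (hre z (by simpa using hz)).symm

/-! ### Signs with controlled fourth moment -/

/-- The left side equals `2 (|z|² + |w|²)² + 8 (Re (z * conj w))²`, and `|Re (z * conj w)| ≤ |z|
|w|`. -/
lemma norm_add_pow_four_add_norm_sub_pow_four_le (z w : ℂ) :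
    ‖z + w‖ ^ 4 + ‖z - w‖ ^ 4 ≤ 2 * (‖z‖ ^ 4 + 6 * (‖z‖ ^ 2 * ‖w‖ ^ 2) + ‖w‖ ^ 4) := by
  have e : ∀ x : ℂ, ‖x‖ ^ 4 = (‖x‖ ^ 2) ^ 2 := fun x => by ring
  simp only [e, Complex.sq_norm, Complex.normSq_apply, Complex.add_re, Complex.add_im,
    Complex.sub_re, Complex.sub_im]
  nlinarith [sq_nonneg (z.re * w.im - z.im * w.re)]

open Finset Real in
/-- A choice of signs for which the polynomial has fourth moment controlled by the second one. -/
lemma exists_norm_eq_circleAverage_pow_four_le (a : ℕ → ℂ) (k : ℕ) :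
    ∃ b : ℕ → ℂ, (∀ n, ‖b n‖ = ‖a n‖) ∧
      circleAverage (fun z => ‖∑ n ∈ range k, b n * z ^ n‖ ^ 4) 0 1 ≤
        3 * (∑ n ∈ range k, ‖a n‖ ^ 2) ^ 2 := by
  induction k with
  | zero => exact ⟨a, fun _ => rfl, by simp [circleAverage]⟩
  | succ k ih =>
    obtain ⟨b, hb, h4⟩ := ih
    set s := ∑ n ∈ range k, ‖a n‖ ^ 2 with hs
    set g : ℂ → ℂ := fun z => ∑ n ∈ range k, b n * z ^ n with hg
    have hgc : Continuous g := by fun_prop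
    have h2 : circleAverage (fun z => ‖g z‖ ^ 2) 0 1 = s := by
      rw [circleAverage_norm_sq_polynomial]; simp [hb, hs]
    have hupd : ∀ c z : ℂ, ∑ n ∈ range (k + 1), Function.update b k c n * z ^ n =
        g z + c * z ^ k := by
      intro c z
      rw [sum_range_succ, Function.update_self]
      congr 1
      refine sum_congr rfl fun n hn => ?_
      rw [Function.update_of_ne (mem_range.1 hn).ne]
    have hnorm : ∀ c : ℂ, ‖c‖ = ‖a k‖ → ∀ n, ‖Function.update b k c n‖ = ‖a n‖ := by
      intro c hc n
      rcases eq_or_ne n k with rfl | hn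
      · simpa using hc
      · simpa [hn] using hb n
    have hsum : circleAverage (fun z => ‖g z + a k * z ^ k‖ ^ 4) 0 1 +
        circleAverage (fun z => ‖g z + -a k * z ^ k‖ ^ 4) 0 1 ≤
        2 * (3 * s ^ 2 + 6 * (s * ‖a k‖ ^ 2) + ‖a k‖ ^ 4) := by
      have hmono : circleAverage (fun z => ‖g z + a k * z ^ k‖ ^ 4 + ‖g z + -a k * z ^ k‖ ^ 4) 0 1 ≤
          circleAverage (fun z => (2 : ℝ) • ‖g z‖ ^ 4 + ((12 * ‖a k‖ ^ 2) • ‖g z‖ ^ 2 +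
            2 * ‖a k‖ ^ 4)) 0 1 := by
        refine circleAverage_mono (Continuous.circleIntegrable (by fun_prop) _ _)
          (Continuous.circleIntegrable (by fun_prop) _ _) fun z hz => ?_
        have hz : ‖z‖ = 1 := by simpa using hz
        have := norm_add_pow_four_add_norm_sub_pow_four_le (g z) (a k * z ^ k)
        rw [norm_mul, norm_pow, hz, one_pow, mul_one] at this
        rw [neg_mul, ← sub_eq_add_neg]
        simp only [smul_eq_mul]
        linarith
      rw [circleAverage_fun_add, circleAverage_fun_add, circleAverage_fun_add,
        circleAverage_fun_smul, circleAverage_fun_smul, circleAverage_const, h2] at hmono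
      · simp only [smul_eq_mul] at hmono
        linarith
      all_goals exact Continuous.circleIntegrable (by fun_prop) _ _
    have hgoal : 3 * s ^ 2 + 6 * (s * ‖a k‖ ^ 2) + ‖a k‖ ^ 4 ≤ 3 * (s + ‖a k‖ ^ 2) ^ 2 := by
      nlinarith [sq_nonneg (‖a k‖ ^ 2)]
    rw [sum_range_succ, ← hs]
    -- The better of the two signs of `a k` does at least as well as their average.
    rcases le_total (circleAverage (fun z => ‖g z + a k * z ^ k‖ ^ 4) 0 1)
      (circleAverage (fun z => ‖g z + -a k * z ^ k‖ ^ 4) 0 1) with hle | hle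
    · refine ⟨Function.update b k (a k), hnorm _ rfl, ?_⟩
      simp only [hupd]
      linarith
    · refine ⟨Function.update b k (-a k), hnorm _ (norm_neg _), ?_⟩
      simp only [hupd]
      linarith

/-! ### Analytic truncation of a polynomial -/

-- Maximum modulus principle for `exp (-h)`.
open Metric in
lemma re_nonneg_of_re_nonneg_on_sphere {h : ℂ → ℂ} (hd : Differentiable ℂ h)
    (hre : ∀ z : ℂ, ‖z‖ = 1 → 0 ≤ (h z).re) {z : ℂ} (hz : ‖z‖ ≤ 1) : 0 ≤ (h z).re := by
  have := Complex.norm_le_of_forall_mem_frontier_norm_le (f := fun z => Complex.exp (-h z))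
    (U := ball (0 : ℂ) 1) (C := 1) isBounded_ball (by fun_prop : Differentiable ℂ _).diffContOnCl
    (fun w hw => by
      rw [frontier_ball _ one_ne_zero, mem_sphere_zero_iff_norm] at hw
      simpa [Complex.norm_exp] using hre w hw)
    (z := z) (by rw [closure_ball _ one_ne_zero]; simpa using hz)
  simpa [Complex.norm_exp] using this

lemma one_add_re_le_norm (w : ℂ) : 1 + w.re ≤ ‖1 + w‖ := by
  simpa using Complex.re_le_norm (1 + w)

open Metric Real in
/-- Analytic truncation: a polynomial `g` with `|g|² = Re h` on the circle is cut off by dividing by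
`1 + δ² h`. -/
lemma truncation_properties {g h : ℂ → ℂ} (hg : Differentiable ℂ g) (hh : Differentiable ℂ h)
    (hre : ∀ z : ℂ, ‖z‖ = 1 → (h z).re = ‖g z‖ ^ 2) {δ : ℝ} (hδ : 0 < δ) :
    DiffContOnCl ℂ (fun z => g z / (1 + δ ^ 2 * h z)) (ball 0 1) ∧
    (∀ z : ℂ, ‖z‖ ≤ 1 → ‖g z / (1 + δ ^ 2 * h z)‖ ≤ 1 / (2 * δ)) ∧
    ∀ z : ℂ, ‖z‖ = 1 →
      ‖g z - g z / (1 + δ ^ 2 * h z)‖ ^ 2 ≤ δ ^ 2 / 2 * (‖g z‖ ^ 4 + ‖h z‖ ^ 2) := by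
  have hre' : ∀ w : ℂ, ((δ : ℂ) ^ 2 * w).re = δ ^ 2 * w.re := by
    intro w; rw [← Complex.ofReal_pow, Complex.re_ofReal_mul]
  have hpos : ∀ z : ℂ, ‖z‖ ≤ 1 → 1 ≤ ‖1 + (δ : ℂ) ^ 2 * h z‖ := by
    intro z hz
    have h1 := one_add_re_le_norm ((δ : ℂ) ^ 2 * h z)
    have h2 := re_nonneg_of_re_nonneg_on_sphere hh (fun w hw => by rw [hre w hw]; positivity) hz
    rw [hre'] at h1
    have := mul_nonneg (sq_nonneg δ) h2
    linarith
  have hne : ∀ z : ℂ, ‖z‖ ≤ 1 → 1 + (δ : ℂ) ^ 2 * h z ≠ 0 := fun z hz h0 => by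
    have := hpos z hz
    rw [h0, norm_zero] at this
    linarith
  have hdc : DiffContOnCl ℂ (fun z => g z / (1 + δ ^ 2 * h z)) (ball 0 1) := by
    refine DifferentiableOn.diffContOnCl fun z hz => ?_
    rw [closure_ball _ one_ne_zero, mem_closedBall_zero_iff] at hz
    exact (DifferentiableAt.div (hg z) (by fun_prop) (hne z hz)).differentiableWithinAt
  refine ⟨hdc, ?_, ?_⟩
  · intro z hz
    refine Complex.norm_le_of_forall_mem_frontier_norm_le isBounded_ball hdc (fun w hw => ?_)
      (by rw [closure_ball _ one_ne_zero]; simpa using hz)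
    rw [frontier_ball _ one_ne_zero, mem_sphere_zero_iff_norm] at hw
    have h1 := one_add_re_le_norm ((δ : ℂ) ^ 2 * h w)
    rw [hre', hre w hw] at h1
    have h2 := hpos w hw.le
    rw [norm_div, div_le_div_iff₀ (by linarith) (by linarith)]
    -- On the circle the denominator has modulus at least `1 + δ² |g|² ≥ 2 δ |g|`.
    nlinarith [sq_nonneg (δ * ‖g w‖ - 1)]
  · intro z hz
    have h1 := hpos z hz.le
    have h0 := hne z hz.le
    set q := ‖1 + (δ : ℂ) ^ 2 * h z‖ with hq
    have e : g z - g z / (1 + δ ^ 2 * h z) = g z * (δ ^ 2 * h z) / (1 + δ ^ 2 * h z) := by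
      field_simp
      ring
    have hn : ‖(δ : ℂ) ^ 2 * h z‖ = δ ^ 2 * ‖h z‖ := by
      rw [norm_mul, norm_pow, Complex.norm_real, norm_eq_abs, sq_abs]
    have hle : δ ^ 2 * ‖h z‖ ≤ q := by
      have hr := hre' (h z)
      rw [hre z hz] at hr
      have hnn : 0 ≤ ((δ : ℂ) ^ 2 * h z).re := by rw [hr]; positivity
      rw [← hn, hq, ← abs_norm, ← abs_norm (1 + _), ← sq_le_sq, Complex.sq_norm, Complex.sq_norm,
        Complex.normSq_apply, Complex.normSq_apply]
      simp only [Complex.add_re, Complex.add_im, Complex.one_re, Complex.one_im, zero_add]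
      nlinarith
    rw [e, norm_div, norm_mul, hn, div_pow, ← hq, div_le_iff₀ (by positivity)]
    have hp : 0 ≤ δ ^ 2 * ‖h z‖ := by positivity
    -- Only one factor `δ² |h|` is spent, through `δ² |h| ≤ q ≤ q²`; this leaves a bound quadratic
    -- in `h`.
    have key : (δ ^ 2 * ‖h z‖) ^ 2 ≤ δ ^ 2 * ‖h z‖ * q ^ 2 := by
      rw [pow_two]
      refine mul_le_mul_of_nonneg_left (hle.trans ?_) hp
      nlinarith
    calc (‖g z‖ * (δ ^ 2 * ‖h z‖)) ^ 2 = ‖g z‖ ^ 2 * (δ ^ 2 * ‖h z‖) ^ 2 := by ring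
      _ ≤ ‖g z‖ ^ 2 * (δ ^ 2 * ‖h z‖ * q ^ 2) := by gcongr
      _ = δ ^ 2 * (‖g z‖ ^ 2 * ‖h z‖) * q ^ 2 := by ring
      _ ≤ δ ^ 2 * ((‖g z‖ ^ 4 + ‖h z‖ ^ 2) / 2) * q ^ 2 := by
        gcongr
        nlinarith [sq_nonneg (‖g z‖ ^ 2 - ‖h z‖)]
      _ = _ := by ring

open Finset in
lemma iteratedDeriv_polynomial_div_factorial (b : ℕ → ℂ) {k n : ℕ} (hn : n < k) :
    iteratedDeriv n (fun z : ℂ => ∑ m ∈ range k, b m * z ^ m) 0 / n.factorial = b n := by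
  have hf : (n.factorial : ℂ) ≠ 0 := by exact_mod_cast n.factorial_ne_zero
  rw [iteratedDeriv_fun_sum fun i _ => by fun_prop]
  have : ∀ m ∈ range k, iteratedDeriv n (fun z : ℂ => b m * z ^ m) 0 =
      if n = m then b n * n.factorial else 0 := by
    intro m _
    rw [iteratedDeriv_const_mul_field, iteratedDeriv_fun_pow_zero]
    split_ifs with h
    · rw [h]
    · simp
  rw [sum_congr rfl this, sum_ite_eq, if_pos (mem_range.2 hn), mul_div_cancel_right₀ _ hf]

open Metric Finset Real in
/-- Every finite sequence is approximated in `ℓ₂`, up to unimodular factors, by the Taylor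
coefficients of a function analytic and uniformly bounded on the disk. -/
lemma exists_bounded_analytic_approx (a : ℕ → ℂ) (k : ℕ) :
    ∃ (F : ℂ → ℂ) (b : ℕ → ℂ), DifferentiableOn ℂ F (ball 0 1) ∧ (∀ n, ‖b n‖ = ‖a n‖) ∧
      (∀ z ∈ ball (0 : ℂ) 1, ‖F z‖ ≤ 5 * √(∑ n ∈ range k, ‖a n‖ ^ 2)) ∧
      ∑ n ∈ range k, ‖b n - iteratedDeriv n F 0 / n.factorial‖ ^ 2 ≤
        (∑ n ∈ range k, ‖a n‖ ^ 2) / 16 := by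
  set s := ∑ n ∈ range k, ‖a n‖ ^ 2 with hs
  have hs0 : 0 ≤ s := by positivity
  rcases hs0.eq_or_lt with h0 | hspos
  · refine ⟨fun _ => 0, a, by fun_prop, fun _ => rfl, fun z _ => by simp, ?_⟩
    have hz : ∀ n : ℕ, iteratedDeriv n (fun _ : ℂ => (0 : ℂ)) 0 = 0 := by
      intro n; simp
    simp only [hz, zero_div, sub_zero]
    rw [← hs, ← h0]
    simp
  obtain ⟨b, hb, h4⟩ := exists_norm_eq_circleAverage_pow_four_le a k
  obtain ⟨h, hd, hh0, hre⟩ := exists_entire_re_eq_norm_sq b k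
  set g : ℂ → ℂ := fun z => ∑ n ∈ range k, b n * z ^ n with hg
  have hgd : Differentiable ℂ g := by fun_prop
  -- This `δ` gives the sup bound `1 / (2 δ) = 5 √s` and the error `(δ² / 2) * 9 s² = 9 s / 200 ≤ s
  -- / 16`.
  have hδ : 0 < 1 / (10 * √s) := by have := sqrt_pos.2 hspos; positivity
  obtain ⟨hdc, hbd, hdiff⟩ := truncation_properties hgd hd hre hδ
  set δ := 1 / (10 * √s) with hδ'
  have hδs : δ ^ 2 * s = 1 / 100 := by
    rw [hδ', div_pow, mul_pow, sq_sqrt hs0]; field_simp; norm_num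
  set F : ℂ → ℂ := fun z => g z / (1 + δ ^ 2 * h z) with hF
  refine ⟨F, b, hdc.differentiableOn, hb, fun z hz => ?_, ?_⟩
  · refine (hbd z (by simpa using (mem_ball_zero_iff.1 hz).le)).trans (le_of_eq ?_)
    rw [hδ']; field_simp; norm_num
  · have hgF : DiffContOnCl ℂ (fun z => g z - F z) (ball 0 1) := hgd.diffContOnCl.sub hdc
    have hB := sum_sq_taylor_le_circleAverage one_pos hgF (range k)
    have hFa : ContDiffAt ℂ ⊤ F 0 :=
      (hdc.differentiableOn.analyticAt (ball_mem_nhds 0 one_pos)).contDiffAt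
    have hcoef : ∀ n ∈ range k, ‖((1 : ℝ) : ℂ) ^ n *
        (iteratedDeriv n (fun z => g z - F z) 0 / n.factorial)‖ ^ 2 =
        ‖b n - iteratedDeriv n F 0 / n.factorial‖ ^ 2 := by
      intro n hn
      rw [iteratedDeriv_fun_sub (hgd.contDiff.contDiffAt.of_le le_top) (hFa.of_le le_top), sub_div,
        hg, iteratedDeriv_polynomial_div_factorial b (mem_range.1 hn)]
      simp
    rw [sum_congr rfl hcoef] at hB
    refine hB.trans ?_
    have hint : CircleIntegrable (fun z => ‖g z - F z‖ ^ 2) 0 1 :=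
      ContinuousOn.circleIntegrable zero_le_one
        ((hgF.continuousOn_ball.mono sphere_subset_closedBall).norm.pow 2)
    have hm : circleAverage (fun z => ‖g z - F z‖ ^ 2) 0 1 ≤
        circleAverage (fun z => (δ ^ 2 / 2) • (‖g z‖ ^ 4 + ‖h z‖ ^ 2)) 0 1 := by
      have := hd.continuous
      have := hgd.continuous
      refine circleAverage_mono hint (Continuous.circleIntegrable (by fun_prop) _ _) fun z hz => ?_
      exact hdiff z (by simpa using hz)
    have hh2 := circleAverage_norm_sq_le hd (by rw [hh0]; exact Complex.ofReal_im _)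
    have he : circleAverage (fun z => (h z).re ^ 2) 0 1 = circleAverage (fun z => ‖g z‖ ^ 4) 0 1 :=
      circleAverage_congr_sphere fun z hz => by
        rw [hre z (by simpa using hz)]
        ring
    rw [circleAverage_fun_smul, circleAverage_fun_add
      (Continuous.circleIntegrable (by have := hgd.continuous; fun_prop) _ _)
      (Continuous.circleIntegrable (by have := hd.continuous; fun_prop) _ _), smul_eq_mul] at hm
    -- `9 = 3 + 2 * 3`: the mean of `|h|²` is at most twice that of `(Re h)² = |g|⁴`.
    have : circleAverage (fun z => ‖g z‖ ^ 4) 0 1 + circleAverage (fun z => ‖h z‖ ^ 2) 0 1 ≤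
        9 * s ^ 2 := by linarith
    have h5 := mul_le_mul_of_nonneg_left this (by positivity : 0 ≤ δ ^ 2 / 2)
    have h6 : δ ^ 2 / 2 * (9 * s ^ 2) = 9 / 200 * s := by
      rw [show δ ^ 2 / 2 * (9 * s ^ 2) = 9 / 2 * (δ ^ 2 * s) * s by ring, hδs]; ring
    linarith

/-! ### Dominating finite sequences by Taylor coefficients of `H_∞` functions -/

open Metric in
/-- The element of `H(𝕌)` given by a function differentiable on the disk. -/
noncomputable def diskRestrict (F : ℂ → ℂ) (hF : DifferentiableOn ℂ F (ball 0 1)) : AnalyticDisk :=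
  ⟨(ball (0 : ℂ) 1).indicator F,
    hF.congr fun _ hz => Set.indicator_of_mem hz F, fun _ hz => Set.indicator_of_notMem hz F⟩

open Metric in
lemma taylorCoeff_diskRestrict {F : ℂ → ℂ} (hF : DifferentiableOn ℂ F (ball 0 1)) (n : ℕ) :
    taylorCoeff (diskRestrict F hF) n = iteratedDeriv n F 0 / n.factorial := by
  have : (diskRestrict F hF : ℂ → ℂ) =ᶠ[nhds 0] F := by
    filter_upwards [ball_mem_nhds (0 : ℂ) one_pos] with z hz
    exact Set.indicator_of_mem hz F
  rw [taylorCoeff, this.iteratedDeriv_eq]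

open Metric in
lemma hardyENorm_top_diskRestrict_le {F : ℂ → ℂ} (hF : DifferentiableOn ℂ F (ball 0 1)) {C : ℝ}
    (hC : ∀ z ∈ ball (0 : ℂ) 1, ‖F z‖ ≤ C) :
    hardyENorm ⊤ (diskRestrict F hF) ≤ ENNReal.ofReal C := by
  have hC0 : 0 ≤ C := (norm_nonneg _).trans (hC 0 (mem_ball_self one_pos))
  refine iSup₂_le fun r _ => ?_
  rw [MeasureTheory.eLpNorm_exponent_top]
  refine MeasureTheory.eLpNormEssSup_le_of_ae_bound (Filter.Eventually.of_forall fun t => ?_)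
  change ‖(ball (0 : ℂ) 1).indicator F _‖ ≤ C
  by_cases hz : (r : ℂ) * Complex.exp (t * Complex.I) ∈ ball (0 : ℂ) 1
  · rw [Set.indicator_of_mem hz]; exact hC _ hz
  · rw [Set.indicator_of_notMem hz, norm_zero]; exact hC0

open Finset in
/-- For every finite sequence there is a function in `H_∞` whose norm is controlled by the `ℓ₂`
norm and whose Taylor coefficients dominate the sequence outside a set carrying a small part of
the `ℓ₂` norm. -/
lemma exists_hardy_top_dominating (a : ℕ → ℂ) (k : ℕ) :
    ∃ f : AnalyticDisk, hardyENorm ⊤ f ≤ ENNReal.ofReal (5 * √(∑ n ∈ range k, ‖a n‖ ^ 2)) ∧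
      ∃ A ⊆ range k, ∑ n ∈ A, ‖a n‖ ^ 2 ≤ (∑ n ∈ range k, ‖a n‖ ^ 2) / 4 ∧
        ∀ n ∈ range k, n ∉ A → ‖a n‖ ≤ 2 * ‖taylorCoeff f n‖ := by
  obtain ⟨F, b, hF, hb, hbd, hsum⟩ := exists_bounded_analytic_approx a k
  refine ⟨diskRestrict F hF, hardyENorm_top_diskRestrict_le hF hbd,
    {n ∈ range k | 2 * ‖taylorCoeff (diskRestrict F hF) n‖ < ‖a n‖}, filter_subset _ _, ?_, ?_⟩
  -- On the exceptional set the approximation error exceeds `|a n| / 2`.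
  · have : ∑ n ∈ range k with 2 * ‖taylorCoeff (diskRestrict F hF) n‖ < ‖a n‖, ‖a n‖ ^ 2 ≤
        ∑ n ∈ range k, 4 * ‖b n - iteratedDeriv n F 0 / n.factorial‖ ^ 2 := by
      refine (sum_le_sum fun n hn => ?_).trans
        (sum_le_sum_of_subset_of_nonneg (filter_subset _ _) fun _ _ _ => by positivity)
      have h1 := (mem_filter.1 hn).2
      rw [taylorCoeff_diskRestrict] at h1
      have h2 := norm_sub_norm_le (b n) (iteratedDeriv n F 0 / n.factorial)
      rw [hb] at h2
      nlinarith [norm_nonneg (a n)]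
    rw [← mul_sum] at this
    linarith
  · intro n hn hA
    by_contra! h
    exact hA (mem_filter.2 ⟨hn, h⟩)

/-! ### From bounded multipliers on `X` to multipliers of `ℓ₂` -/

/-- The coordinate functionals of a sequence space continuously included in `ℓ_∞`. -/
lemma exists_coordinate_clm {E : Type*} [NormedAddCommGroup E] [NormedSpace ℂ E]
    {S : E →ₗ[ℂ] (ℕ → ℂ)} (hS : EmbedsIntoLInfty S) (n : ℕ) :
    ∃ φ : E →L[ℂ] ℂ, ∀ x, φ x = S x n := by
  obtain ⟨C, hC⟩ := hS
  exact ⟨((LinearMap.proj n).comp S).mkContinuous C fun x => hC x n, fun x => rfl⟩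

-- The element is the image under `M` of the monomial `z ^ n`, which lies in `H_∞`.
open Metric in
lemma exists_unit_multiple_mem {X E : Type*} [NormedAddCommGroup X] [NormedSpace ℂ X]
    [NormedAddCommGroup E] [NormedSpace ℂ E] {J : X →ₗ[ℂ] AnalyticDisk}
    (hJ : HardyEmbedsInto ⊤ J) {S : E →ₗ[ℂ] (ℕ → ℂ)} {l : ℕ → ℂ}
    {M : X →L[ℂ] E} (hM : ∀ x n, S (M x) n = l n * taylorCoeff (J x) n) (n : ℕ) :
    ∃ b : E, S b = Pi.single n (l n) := by
  obtain ⟨C, hC⟩ := hJ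
  have hd : DifferentiableOn ℂ (fun z : ℂ => z ^ n) (ball 0 1) := by fun_prop
  have hle := hardyENorm_top_diskRestrict_le hd (C := 1) fun z hz => by
    rw [norm_pow]
    exact pow_le_one₀ (norm_nonneg _) (mem_ball_zero_iff.1 hz).le
  obtain ⟨x, hx, -⟩ := hC _ (hle.trans_lt ENNReal.ofReal_lt_top)
  refine ⟨M x, ?_⟩
  ext m
  rw [hM, hx, taylorCoeff_diskRestrict, iteratedDeriv_fun_pow_zero]
  have hf : (n.factorial : ℂ) ≠ 0 := by exact_mod_cast n.factorial_ne_zero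
  rcases eq_or_ne m n with rfl | h
  · simp [hf]
  · simp [h]

open Finset in
/-- A multiplier bounded on `H_∞` is bounded in the `ℓ₂` norm on finite sequences. -/
lemma exists_bound_finite_multiplier {X E : Type*} [NormedAddCommGroup X] [NormedSpace ℂ X]
    [NormedAddCommGroup E] [NormedSpace ℂ E] {J : X →ₗ[ℂ] AnalyticDisk}
    (hJ : HardyEmbedsInto ⊤ J) {S : E →ₗ[ℂ] (ℕ → ℂ)} (hS : IsBanachSequenceLattice S) {l : ℕ → ℂ}
    {M : X →L[ℂ] E} (hM : ∀ x n, S (M x) n = l n * taylorCoeff (J x) n)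
    {b : ℕ → E} (hb : ∀ n, S (b n) = Pi.single n (l n)) :
    ∃ K : ℝ, 0 ≤ K ∧ ∀ (a : ℕ → ℂ) (k : ℕ),
      ‖∑ n ∈ range k, a n • b n‖ ≤ K * √(∑ n ∈ range k, ‖a n‖ ^ 2) := by
  obtain ⟨C, hC⟩ := hJ
  set K : ℝ := 10 * C * ‖M‖ with hK
  have hK0 : 0 ≤ K := by positivity
  refine ⟨2 * K, by positivity, fun a k => ?_⟩
  have hcoord : ∀ (c : ℕ → ℂ) (m : ℕ), S (∑ n ∈ range k, c n • b n) m =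
      if m ∈ range k then c m * l m else 0 := by
    intro c m
    simp only [map_sum, map_smul, hb, Finset.sum_apply, Pi.smul_apply, smul_eq_mul, Pi.single_apply]
    simp
  -- Self-improvement of a bound `B`: the dominated part costs `K`, and the rest has at most half
  -- the `ℓ₂` norm. Iteration tends to the fixed point `2 K`.
  have hstep : ∀ B : ℝ, 0 ≤ B →
      (∀ c : ℕ → ℂ, ‖∑ n ∈ range k, c n • b n‖ ≤ B * √(∑ n ∈ range k, ‖c n‖ ^ 2)) →
      ∀ c : ℕ → ℂ, ‖∑ n ∈ range k, c n • b n‖ ≤ (K + B / 2) * √(∑ n ∈ range k, ‖c n‖ ^ 2) := by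
    intro B hB0 hB c
    obtain ⟨f, hf, A, hA, hAs, hdom⟩ := exists_hardy_top_dominating c k
    set s := ∑ n ∈ range k, ‖c n‖ ^ 2 with hs
    obtain ⟨x, hxf, hx⟩ := hC f (hf.trans_lt ENNReal.ofReal_lt_top)
    have hx' : ‖x‖ ≤ C * (5 * √s) := by
      have h1 : ENNReal.ofReal ‖x‖ ≤ ENNReal.ofReal (C * (5 * √s)) := by
        rw [ofReal_norm, ENNReal.ofReal_mul C.coe_nonneg, ENNReal.ofReal_coe_nnreal]
        exact hx.trans (by gcongr)
      exact (ENNReal.ofReal_le_ofReal_iff (by positivity)).1 h1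
    have hsplit : ∑ n ∈ range k, c n • b n =
        ∑ n ∈ range k, (if n ∈ A then 0 else c n) • b n +
          ∑ n ∈ range k, (if n ∈ A then c n else 0) • b n := by
      rw [← sum_add_distrib]
      refine sum_congr rfl fun n _ => ?_
      split_ifs <;> simp
    have hsmall : ‖∑ n ∈ range k, (if n ∈ A then c n else 0) • b n‖ ≤ B * (√s / 2) := by
      refine (hB _).trans (mul_le_mul_of_nonneg_left ?_ hB0)
      have e : ∑ n ∈ range k, ‖if n ∈ A then c n else 0‖ ^ 2 = ∑ n ∈ A, ‖c n‖ ^ 2 := by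
        rw [← sum_subset hA (f := fun n => ‖if n ∈ A then c n else 0‖ ^ 2)]
        · exact sum_congr rfl fun n hn => by rw [if_pos hn]
        · intro n _ hn; simp [hn]
      rw [e]
      calc √(∑ n ∈ A, ‖c n‖ ^ 2) ≤ √(s / 4) := Real.sqrt_le_sqrt hAs
        _ = √s / 2 := by
          rw [Real.sqrt_div' _ (by norm_num), show (4 : ℝ) = 2 ^ 2 by norm_num,
            Real.sqrt_sq (by norm_num)]
    have hlarge : ‖∑ n ∈ range k, (if n ∈ A then 0 else c n) • b n‖ ≤ K * √s := by
      obtain ⟨y, hy, hyn⟩ := hS.solid (M ((2 : ℂ) • x))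
        (S (∑ n ∈ range k, (if n ∈ A then 0 else c n) • b n)) fun n => by
          rw [hcoord, map_smul, map_smul, Pi.smul_apply, hM, hxf]
          split_ifs with h1 h2
          · rw [zero_mul, norm_zero]; positivity
          · rw [norm_mul, smul_eq_mul, norm_mul, norm_mul, Complex.norm_ofNat]
            nlinarith [hdom n h1 h2, norm_nonneg (l n)]
          · rw [norm_zero]; positivity
      rw [← hS.injective hy]
      calc ‖y‖ ≤ ‖M ((2 : ℂ) • x)‖ := hyn
        _ ≤ ‖M‖ * ‖(2 : ℂ) • x‖ := M.le_opNorm _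
        _ = ‖M‖ * (2 * ‖x‖) := by rw [norm_smul, Complex.norm_ofNat]
        _ ≤ ‖M‖ * (2 * (C * (5 * √s))) := by gcongr
        _ = K * √s := by rw [hK]; ring
    rw [hsplit]
    refine (norm_add_le _ _).trans ?_
    linarith
  -- The starting bound depends on `k`, but its contribution is halved at each step and disappears
  -- in the limit.
  have hbase : ∀ c : ℕ → ℂ, ‖∑ n ∈ range k, c n • b n‖ ≤
      (∑ n ∈ range k, ‖b n‖) * √(∑ n ∈ range k, ‖c n‖ ^ 2) := by
    intro c
    refine (norm_sum_le _ _).trans ?_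
    rw [sum_mul]
    refine sum_le_sum fun n hn => ?_
    rw [norm_smul, mul_comm]
    refine mul_le_mul_of_nonneg_left (Real.le_sqrt_of_sq_le ?_) (norm_nonneg _)
    exact single_le_sum (f := fun n => ‖c n‖ ^ 2) (fun _ _ => by positivity) hn
  set B₀ := ∑ n ∈ range k, ‖b n‖
  have hB₀ : 0 ≤ B₀ := by positivity
  have hiter : ∀ (j : ℕ) (c : ℕ → ℂ), ‖∑ n ∈ range k, c n • b n‖ ≤
      (2 * K + B₀ * (1 / 2) ^ j) * √(∑ n ∈ range k, ‖c n‖ ^ 2) := by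
    intro j
    induction j with
    | zero =>
      intro c
      refine (hbase c).trans (mul_le_mul_of_nonneg_right ?_ (Real.sqrt_nonneg _))
      simp [hK0]
    | succ j ih =>
      intro c
      convert hstep _ (by positivity) ih c using 2
      ring
  have hlim : Filter.Tendsto
      (fun j : ℕ => (2 * K + B₀ * (1 / 2) ^ j) * √(∑ n ∈ range k, ‖a n‖ ^ 2)) Filter.atTop
      (nhds ((2 * K + B₀ * 0) * √(∑ n ∈ range k, ‖a n‖ ^ 2))) :=
    (((tendsto_pow_atTop_nhds_zero_of_lt_one (by norm_num) (by norm_num)).const_mul _).const_add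
      _).mul_const _
  simpa using ge_of_tendsto' hlim fun j => hiter j a

lemma summable_norm_sq_of_memℓp {x : ℕ → ℂ} (hx : Memℓp x 2) : Summable fun n => ‖x n‖ ^ 2 := by
  have := hx.summable (by simp)
  simpa using this

open Finset in
/-- A multiplier bounded from `H_∞` into a Banach sequence lattice acts on `ℓ₂`. -/
theorem mem_multipliers_of_bounded {X E : Type*} [NormedAddCommGroup X] [NormedSpace ℂ X]
    [NormedAddCommGroup E] [NormedSpace ℂ E] {J : X →ₗ[ℂ] AnalyticDisk}
    (hJ : HardyEmbedsInto ⊤ J) {S : E →ₗ[ℂ] (ℕ → ℂ)} (hS : IsBanachSequenceLattice S)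
    (hS' : EmbedsIntoLInfty S) {l : ℕ → ℂ}
    {M : X →L[ℂ] E} (hM : ∀ x n, S (M x) n = l n * taylorCoeff (J x) n) :
    l ∈ multipliers ellTwo (Set.range S) := by
  have := hS.complete
  choose b hb using exists_unit_multiple_mem hJ hM
  obtain ⟨K, hK0, hK⟩ := exists_bound_finite_multiplier hJ hS hM hb
  intro x hx
  have hfin : ∀ t : Finset ℕ, ‖∑ n ∈ t, x n • b n‖ ≤ K * √(∑ n ∈ t, ‖x n‖ ^ 2) := by
    intro t
    obtain ⟨k, hk⟩ := t.exists_nat_subset_range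
    have h := hK (fun n => if n ∈ t then x n else 0) k
    have e₁ : ∑ n ∈ range k, (if n ∈ t then x n else 0) • b n = ∑ n ∈ t, x n • b n := by
      rw [← sum_subset hk (f := fun n => (if n ∈ t then x n else 0) • b n)]
      · exact sum_congr rfl fun n hn => by rw [if_pos hn]
      · intro n _ hn; simp [hn]
    have e₂ : ∑ n ∈ range k, ‖if n ∈ t then x n else 0‖ ^ 2 = ∑ n ∈ t, ‖x n‖ ^ 2 := by
      rw [← sum_subset hk (f := fun n => ‖if n ∈ t then x n else 0‖ ^ 2)]
      · exact sum_congr rfl fun n hn => by rw [if_pos hn]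
      · intro n _ hn; simp [hn]
    rwa [e₁, e₂] at h
  have hsum : Summable fun n => x n • b n := by
    rw [summable_iff_vanishing_norm]
    intro ε hε
    have hpos : 0 < (ε / (K + 1)) ^ 2 := by positivity
    obtain ⟨s, hs⟩ := summable_iff_vanishing_norm.1 (summable_norm_sq_of_memℓp hx) _ hpos
    refine ⟨s, fun t ht => (hfin t).trans_lt ?_⟩
    have h1 := (le_abs_self _).trans_lt (hs t ht)
    have h2 : √(∑ n ∈ t, ‖x n‖ ^ 2) < ε / (K + 1) := (Real.sqrt_lt' (by positivity)).2 h1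
    calc K * √(∑ n ∈ t, ‖x n‖ ^ 2) ≤ (K + 1) * √(∑ n ∈ t, ‖x n‖ ^ 2) := by gcongr; linarith
      _ < (K + 1) * (ε / (K + 1)) := by gcongr
      _ = ε := by field_simp
  refine ⟨∑' n, x n • b n, ?_⟩
  ext m
  obtain ⟨φ, hφ⟩ := exists_coordinate_clm hS' m
  rw [← hφ, φ.map_tsum hsum, tsum_eq_single m]
  · rw [hφ, map_smul, hb]; simp [mul_comm]
  · intro n hn
    rw [hφ, map_smul, hb]; simp [hn.symm]

/-! ### Taylor coefficients as an operator from `X` to `ℓ₂` -/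

lemma contDiffAt_analyticDisk (f : AnalyticDisk) (n : ℕ) : ContDiffAt ℂ n (f : ℂ → ℂ) 0 :=
  (f.2.1.analyticAt (Metric.ball_mem_nhds 0 one_pos)).contDiffAt

lemma taylorCoeff_add (f g : AnalyticDisk) (n : ℕ) :
    taylorCoeff (f + g) n = taylorCoeff f n + taylorCoeff g n := by
  simp only [taylorCoeff, Submodule.coe_add]
  rw [iteratedDeriv_add (contDiffAt_analyticDisk f n) (contDiffAt_analyticDisk g n), add_div]

lemma taylorCoeff_smul (c : ℂ) (f : AnalyticDisk) (n : ℕ) :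
    taylorCoeff (c • f) n = c * taylorCoeff f n := by
  simp only [taylorCoeff, Submodule.coe_smul]
  rw [iteratedDeriv_const_smul_field, smul_eq_mul, mul_div_assoc]

open Metric Real MeasureTheory in
/-- The `L₂` norm of an analytic function on a circle as a circle average. -/
lemma circleAverage_norm_sq_le_of_eLpNorm_le {f : AnalyticDisk} {r B : ℝ} (hr : r ∈ Set.Ico 0 1)
    (hB : 0 ≤ B) (h : eLpNorm (fun t : ℝ => (f : ℂ → ℂ) (r * Complex.exp (t * Complex.I))) 2
      circleMeasure ≤ ENNReal.ofReal B) :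
    circleAverage (fun z => ‖(f : ℂ → ℂ) z‖ ^ 2) 0 r ≤ B ^ 2 := by
  have hcont : Continuous fun t : ℝ => (f : ℂ → ℂ) (r * Complex.exp (t * Complex.I)) := by
    refine f.2.1.continuousOn.comp_continuous (by fun_prop) fun t => ?_
    simpa [Complex.norm_exp_ofReal_mul_I, abs_of_nonneg hr.1] using hr.2
  have hmem : MemLp (fun t : ℝ => (f : ℂ → ℂ) (r * Complex.exp (t * Complex.I))) 2
      circleMeasure := ⟨hcont.aestronglyMeasurable, h.trans_lt ENNReal.ofReal_lt_top⟩
  rw [hmem.eLpNorm_eq_integral_rpow_norm (by simp) (by simp),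
    ENNReal.ofReal_le_ofReal_iff hB] at h
  have e : circleAverage (fun z => ‖(f : ℂ → ℂ) z‖ ^ 2) 0 r =
      ∫ t, ‖(f : ℂ → ℂ) (r * Complex.exp (t * Complex.I))‖ ^ 2 ∂circleMeasure := by
    rw [circleAverage, circleMeasure, integral_smul_measure, ENNReal.toReal_inv,
      ENNReal.toReal_ofReal two_pi_pos.le, intervalIntegral.integral_of_le two_pi_pos.le]
    simp [circleMap]
  rw [e]
  simp only [ENNReal.toReal_ofNat, rpow_ofNat] at h
  rw [← one_div, ← sqrt_eq_rpow] at h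
  exact (sqrt_le_left hB).1 h

-- Bessel on each circle of radius `r < 1`, then `r → 1` in a finite sum.
open Metric Real Filter in
lemma sum_norm_sq_taylorCoeff_le {f : AnalyticDisk} {B : ℝ} (hB : 0 ≤ B)
    (hf : hardyENorm 2 f ≤ ENNReal.ofReal B) (s : Finset ℕ) :
    ∑ n ∈ s, ‖taylorCoeff f n‖ ^ 2 ≤ B ^ 2 := by
  have hr : ∀ r ∈ Set.Ioo (0 : ℝ) 1, ∑ n ∈ s, ‖(r : ℂ) ^ n * taylorCoeff f n‖ ^ 2 ≤ B ^ 2 := by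
    intro r hr
    have hd : DiffContOnCl ℂ (f : ℂ → ℂ) (ball 0 r) :=
      (f.2.1.mono (by
        rw [closure_ball _ hr.1.ne']
        exact closedBall_subset_ball hr.2)).diffContOnCl
    refine (sum_sq_taylor_le_circleAverage hr.1 hd s).trans ?_
    have hr' : r ∈ Set.Ico (0 : ℝ) 1 := ⟨hr.1.le, hr.2⟩
    refine circleAverage_norm_sq_le_of_eLpNorm_le hr' hB (le_trans ?_ hf)
    exact le_iSup₂ (f := fun (r : ℝ) (_ : r ∈ Set.Ico (0 : ℝ) 1) => MeasureTheory.eLpNorm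
      (fun t : ℝ => (f : ℂ → ℂ) (r * Complex.exp (t * Complex.I))) 2 circleMeasure) r hr'
  have hc : Continuous fun r : ℝ => ∑ n ∈ s, ‖(r : ℂ) ^ n * taylorCoeff f n‖ ^ 2 := by fun_prop
  have hlim := (hc.tendsto 1).mono_left (nhdsWithin_le_nhds (s := Set.Iio 1))
  have := le_of_tendsto hlim (by
    filter_upwards [Ioo_mem_nhdsLT (zero_lt_one' ℝ)] with r h using hr r h)
  simpa using this

/-- A space continuously included in `H_2` is mapped continuously into `ℓ_2` by the Taylor
coefficients. -/
lemma exists_taylorCoeff_clm {X : Type*} [NormedAddCommGroup X] [NormedSpace ℂ X]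
    {J : X →ₗ[ℂ] AnalyticDisk} (hJ : EmbedsIntoHardy 2 J) :
    ∃ T : X →L[ℂ] lp (fun _ : ℕ => ℂ) 2, ∀ x n, T x n = taylorCoeff (J x) n := by
  obtain ⟨C, hC⟩ := hJ
  have hb : ∀ x (s : Finset ℕ), ∑ n ∈ s, ‖taylorCoeff (J x) n‖ ^ 2 ≤ (C * ‖x‖) ^ 2 := by
    intro x s
    refine sum_norm_sq_taylorCoeff_le (by positivity) ((hC x).trans (le_of_eq ?_)) s
    rw [ENNReal.ofReal_mul C.coe_nonneg, ENNReal.ofReal_coe_nnreal, ofReal_norm]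
  let T : X →ₗ[ℂ] lp (fun _ : ℕ => ℂ) 2 :=
    { toFun := fun x => ⟨fun n => taylorCoeff (J x) n,
        memℓp_gen' (C := (C * ‖x‖) ^ 2) fun s => by simpa using hb x s⟩
      map_add' := fun x y => by ext n; simp [taylorCoeff_add]; rfl
      map_smul' := fun c x => by ext n; simp [taylorCoeff_smul] }
  refine ⟨T.mkContinuous C fun x => ?_, fun x n => rfl⟩
  exact lp.norm_le_of_forall_sum_le (by simp) (by positivity) fun s => by simpa [T] using hb x s

/-! ### Diagonal operators and truncations on `ℓ₂` -/

open Filter in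
/-- A multiplier of `ℓ₂` into a Banach sequence lattice is bounded, by the closed graph theorem. -/
lemma exists_multiplier_clm {E : Type*} [NormedAddCommGroup E] [NormedSpace ℂ E]
    {S : E →ₗ[ℂ] (ℕ → ℂ)} (hS : IsBanachSequenceLattice S) (hS' : EmbedsIntoLInfty S)
    {l : ℕ → ℂ} (hl : l ∈ multipliers ellTwo (Set.range S)) :
    ∃ D : lp (fun _ : ℕ => ℂ) 2 →L[ℂ] E, ∀ x n, S (D x) n = l n * x n := by
  have := hS.complete
  choose d hd using fun x : lp (fun _ : ℕ => ℂ) 2 => hl x (lp.memℓp x)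
  have hd' : ∀ x n, S (d x) n = l n * x n := fun x n => congrFun (hd x) n
  let D : lp (fun _ : ℕ => ℂ) 2 →ₗ[ℂ] E :=
    { toFun := d
      map_add' := fun x y => hS.injective <| by ext n; simp [hd', mul_add]
      map_smul' := fun c x => hS.injective <| by ext n; simp [hd']; ring }
  have hD : Continuous D := by
    refine D.continuous_of_seq_closed_graph fun v x y hv hy => hS.injective ?_
    ext n
    obtain ⟨φ, hφ⟩ := exists_coordinate_clm hS' n
    have h1 := (φ.continuous.tendsto y).comp hy
    have h2 : Tendsto (fun j => l n * v j n) atTop (nhds (l n * x n)) :=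
      (((lp.evalCLM ℂ (fun _ : ℕ => ℂ) 2 n).continuous.tendsto x).comp hv).const_mul _
    have h3 : (φ ∘ D ∘ v) = fun j => l n * v j n := by
      ext j
      simp only [Function.comp_apply, hφ]
      exact hd' _ n
    rw [h3] at h1
    rw [← hφ, tendsto_nhds_unique h1 h2]
    exact (hd' x n).symm
  exact ⟨⟨D, hD⟩, hd'⟩

/-- Truncation of a sequence in `ℓ₂` to the first `N` coordinates. -/
noncomputable def ellTwoTrunc (N : ℕ) : lp (fun _ : ℕ => ℂ) 2 →L[ℂ] lp (fun _ : ℕ => ℂ) 2 :=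
  ∑ n ∈ Finset.range N, (lp.singleContinuousLinearMap ℂ (fun _ : ℕ => ℂ) 2 n).comp
    (lp.evalCLM ℂ (fun _ : ℕ => ℂ) 2 n)

lemma ellTwoTrunc_eq_sum (N : ℕ) (v : lp (fun _ : ℕ => ℂ) 2) :
    ellTwoTrunc N v = ∑ n ∈ Finset.range N, lp.single 2 n (v n) := by
  simp only [ellTwoTrunc, sum_apply]
  rfl

lemma ellTwoTrunc_apply (N : ℕ) (v : lp (fun _ : ℕ => ℂ) 2) (n : ℕ) :
    ellTwoTrunc N v n = if n < N then v n else 0 := by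
  rw [ellTwoTrunc_eq_sum, lp.coeFn_sum, Finset.sum_apply]
  simp [Pi.single_apply]

lemma tendsto_ellTwoTrunc (v : lp (fun _ : ℕ => ℂ) 2) :
    Filter.Tendsto (fun N => ellTwoTrunc N v) Filter.atTop (nhds v) := by
  simp_rw [ellTwoTrunc_eq_sum]
  exact (lp.hasSum_single (by simp) v).tendsto_sum_nat

lemma isCompactOperator_ellTwoTrunc (N : ℕ) : IsCompactOperator (ellTwoTrunc N) := by
  have : ellTwoTrunc N ∈ compactOperator (RingHom.id ℂ) (lp (fun _ : ℕ => ℂ) 2)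
      (lp (fun _ : ℕ => ℂ) 2) :=
    Submodule.sum_mem _ fun n _ =>
      (isCompactOperator_of_locallyCompactSpace_dom (lp.evalCLM ℂ (fun _ : ℕ => ℂ) 2 n)).clm_comp
        (lp.singleContinuousLinearMap ℂ (fun _ : ℕ => ℂ) 2 n)
  exact this

/-! ### Compactness from the lower estimate -/

lemma inner_eq_zero_of_disjoint {v w : lp (fun _ : ℕ => ℂ) 2} (h : ∀ n, v n = 0 ∨ w n = 0) :
    inner ℂ v w = 0 := by
  rw [lp.inner_eq_tsum]
  refine (tsum_congr fun n => ?_).trans tsum_zero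
  rcases h n with h | h <;> simp [h]

lemma norm_sum_sq_le_of_disjoint {w : ℕ → lp (fun _ : ℕ => ℂ) 2} (hw : ∀ i, ‖w i‖ ≤ 1)
    (hdisj : ∀ i j, i < j → ∀ n, w i n = 0 ∨ w j n = 0) (m : ℕ) :
    ‖∑ i ∈ Finset.range m, w i‖ ^ 2 ≤ m := by
  induction m with
  | zero => simp
  | succ m ih =>
    have h0 : inner ℂ (∑ i ∈ Finset.range m, w i) (w m) = 0 := by
      rw [sum_inner]
      exact Finset.sum_eq_zero fun i hi =>
        inner_eq_zero_of_disjoint (hdisj i m (Finset.mem_range.1 hi))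
    have h1 := norm_add_sq_eq_norm_sq_add_norm_sq_of_inner_eq_zero _ _ h0
    rw [Finset.sum_range_succ, pow_two, h1]
    push_cast
    nlinarith [hw m, norm_nonneg (w m)]

open Filter in
/-- Under a lower `u`-estimate with `u < 2`, an operator from `ℓ₂` which preserves disjointness
cannot be bounded below on arbitrarily many disjoint blocks. -/
lemma exists_small_on_blocks {E : Type*} [NormedAddCommGroup E] [NormedSpace ℂ E]
    {S : E →ₗ[ℂ] (ℕ → ℂ)} {u : ℝ} (hu₀ : 0 < u) (hu₂ : u < 2) (hlow : LowerEstimate u S)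
    (D : lp (fun _ : ℕ => ℂ) 2 →L[ℂ] E) (hD : ∀ v n, v n = 0 → S (D v) n = 0)
    {δ : ℝ} (hδ : 0 < δ) :
    ∃ N, ∀ (M : ℕ) (v : lp (fun _ : ℕ => ℂ) 2), ‖v‖ ≤ 1 → (∀ n, v n ≠ 0 → N ≤ n ∧ n < M) →
      ‖D v‖ ≤ δ := by
  by_contra! hcon
  choose M v hv1 hsupp hδv using hcon
  -- Each block starts where the previous one ends: the `k`-th is supported in `[p k, p (k + 1))`.
  let p : ℕ → ℕ := fun k => M^[k] 0
  have hp : ∀ k, p (k + 1) = M (p k) := fun k => Function.iterate_succ_apply' M k 0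
  have hmono : Monotone p := monotone_nat_of_le_succ fun k => by
    rw [hp]
    by_contra! hlt
    have hz : v (p k) = 0 := by
      ext n
      by_contra hn
      have := hsupp (p k) n hn
      omega
    have := hδv (p k)
    rw [hz, map_zero, norm_zero] at this
    linarith
  set w : ℕ → lp (fun _ : ℕ => ℂ) 2 := fun k => v (p k) with hw
  have hdisj : ∀ i j, i < j → ∀ n, w i n = 0 ∨ w j n = 0 := by
    intro i j hij n
    by_contra! h
    have h1 := (hsupp _ n h.1).2
    have h2 := (hsupp _ n h.2).1
    rw [← hp] at h1
    have := hmono (Nat.succ_le_of_lt hij)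
    simp only [Nat.succ_eq_add_one] at this
    omega
  obtain ⟨C, hC, hest⟩ := hlow
  -- Lower `u`-estimate for the images against Pythagoras for the blocks.
  have hineq : ∀ m : ℕ, 1 / C * ((m : ℝ) ^ (1 / u) * δ) ≤ ‖D‖ * (m : ℝ) ^ (1 / 2 : ℝ) := by
    intro m
    have h1 := hest m (fun i => D (w i)) fun i j hij n => by
      rcases lt_or_gt_of_ne hij with h | h
      · exact (hdisj i j h n).imp (hD _ _) (hD _ _)
      · exact ((hdisj j i h n).imp (hD _ _) (hD _ _)).symm
    have h2 : ‖∑ i : Fin m, D (w i)‖ ≤ ‖D‖ * (m : ℝ) ^ (1 / 2 : ℝ) := by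
      rw [← map_sum, Fin.sum_univ_eq_sum_range (fun i => w i)]
      refine (D.le_opNorm _).trans ?_
      gcongr
      rw [← Real.sqrt_eq_rpow]
      exact Real.le_sqrt_of_sq_le (norm_sum_sq_le_of_disjoint (fun i => hv1 _) hdisj m)
    have h3 : (m : ℝ) ^ (1 / u) * δ ≤ (∑ i : Fin m, ‖D (w i)‖ ^ u) ^ (1 / u) := by
      calc (m : ℝ) ^ (1 / u) * δ = ((m : ℝ) * δ ^ u) ^ (1 / u) := by
            rw [Real.mul_rpow (by positivity) (by positivity), ← Real.rpow_mul hδ.le,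
              mul_one_div_cancel hu₀.ne', Real.rpow_one]
        _ = (∑ i : Fin m, δ ^ u) ^ (1 / u) := by simp
        _ ≤ _ := by
            gcongr with i
            exact (hδv _).le
    exact (mul_le_mul_of_nonneg_left h3 (by positivity)).trans (h1.trans h2)
  have hexp : 0 < 1 / u - 1 / 2 := by
    rw [sub_pos]; exact one_div_lt_one_div_of_lt hu₀ hu₂
  have hlim : Tendsto (fun m : ℕ => (m : ℝ) ^ (1 / u - 1 / 2)) atTop atTop :=
    (tendsto_rpow_atTop hexp).comp tendsto_natCast_atTop_atTop
  obtain ⟨m, hm, hm0⟩ :=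
    ((hlim.eventually_gt_atTop (‖D‖ * C / δ)).and (eventually_gt_atTop 0)).exists
  have hmpos : (0 : ℝ) < m := by exact_mod_cast hm0
  have h := hineq m
  rw [show 1 / u = (1 / u - 1 / 2) + 1 / 2 by ring, Real.rpow_add hmpos] at h
  have hh : 0 < (m : ℝ) ^ (1 / 2 : ℝ) := by positivity
  rw [div_lt_iff₀ hδ] at hm
  have h' : 1 / C * ((m : ℝ) ^ (1 / u - 1 / 2) * δ) ≤ ‖D‖ := by
    refine le_of_mul_le_mul_right ?_ hh
    linarith
  rw [one_div, inv_mul_le_iff₀ hC] at h'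
  linarith

-- The tails of `D` tend to zero in norm, so `D` is a limit of finite-rank operators.
open Filter in
lemma isCompactOperator_of_lowerEstimate {E : Type*} [NormedAddCommGroup E] [NormedSpace ℂ E]
    [CompleteSpace E] {S : E →ₗ[ℂ] (ℕ → ℂ)} {u : ℝ} (hu₀ : 0 < u) (hu₂ : u < 2)
    (hlow : LowerEstimate u S) (D : lp (fun _ : ℕ => ℂ) 2 →L[ℂ] E)
    (hD : ∀ v n, v n = 0 → S (D v) n = 0) : IsCompactOperator D := by
  have hlim : Tendsto (fun N => D.comp (ellTwoTrunc N)) atTop (nhds D) := by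
    rw [Metric.tendsto_atTop]
    intro ε hε
    obtain ⟨N₀, hN₀⟩ := exists_small_on_blocks hu₀ hu₂ hlow D hD (half_pos hε)
    refine ⟨N₀, fun N hN => lt_of_le_of_lt ?_ (half_lt_self hε)⟩
    rw [dist_comm, dist_eq_norm]
    refine ContinuousLinearMap.opNorm_le_of_unit_norm (half_pos hε).le fun v hv => ?_
    have hcoord : ∀ n, (v - ellTwoTrunc N v) n = if n < N then 0 else v n := by
      intro n
      rw [lp.coeFn_sub, Pi.sub_apply, ellTwoTrunc_apply]
      split_ifs <;> simp
    have hw := tendsto_ellTwoTrunc (v - ellTwoTrunc N v)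
    have hDw := ((D.continuous.tendsto _).comp hw).norm
    have : ‖D (v - ellTwoTrunc N v)‖ ≤ ε / 2 := by
      -- The block estimate needs finite support, so the tail is cut at `M` before `M → ∞`.
      refine le_of_tendsto' hDw fun M => hN₀ M _ ?_ fun n hn => ?_
      · rw [← hv]
        refine lp.norm_mono (by simp) fun n => ?_
        rw [ellTwoTrunc_apply, hcoord]
        split_ifs <;> simp
      · rw [ellTwoTrunc_apply, hcoord] at hn
        split_ifs at hn with h1 h2
        · exact absurd rfl hn
        · exact ⟨by omega, h1⟩
        · exact absurd rfl hn
    simpa using this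
  exact isCompactOperator_of_tendsto hlim
    (Eventually.of_forall fun N => (isCompactOperator_ellTwoTrunc N).clm_comp D)

theorem mainTheorem2
    {X : Type*} [NormedAddCommGroup X] [NormedSpace ℂ X] [CompleteSpace X]
    (J : X →ₗ[ℂ] AnalyticDisk) (hJ : Function.Injective J)
    (hX₁ : HardyEmbedsInto ⊤ J) (hX₂ : EmbedsIntoHardy 2 J)
    {E : Type*} [NormedAddCommGroup E] [NormedSpace ℂ E]
    (S : E →ₗ[ℂ] (ℕ → ℂ)) (hE : IsBanachSequenceLattice S) (hE' : EmbedsIntoLInfty S)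
    (u : ℝ) (hu₀ : 0 < u) (hu₂ : u < 2) (hlow : LowerEstimate u S)
    (l : ℕ → ℂ) :
    IsCompactMultiplier J S l ↔ l ∈ multipliers ellTwo (Set.range S) := by
  constructor
  · rintro ⟨M, hM, -⟩
    exact mem_multipliers_of_bounded hX₁ hE hE' hM
  · intro hl
    have := hE.complete
    obtain ⟨D, hD⟩ := exists_multiplier_clm hE hE' hl
    obtain ⟨T, hT⟩ := exists_taylorCoeff_clm hX₂
    have hcomp : IsCompactOperator D :=
      isCompactOperator_of_lowerEstimate hu₀ hu₂ hlow D fun v n hv => by rw [hD, hv, mul_zero]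
    exact ⟨D.comp T, fun x n => by rw [ContinuousLinearMap.comp_apply, hD, hT], hcomp.comp_clm T⟩
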